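/- For a metric space $X$ and a real number $a$, let $\mathrm{Rips}(X,a)$ be the abstract simplicial complex with vertex set $X$ whose simplices are the nonempty finite subsets of $X$ in which any two distinct points are at distance at most $a$. Let $\mathbf{k}$ be an arbitrary field, and let $H_k(\,\cdot\,)$ denote simplicial homology with coefficients in $\mathbf{k}$. Proposition. For any real numbers $\alpha,\beta$ with $0<\alpha\le\beta$ and any integer $k\ge 1$ there exists a compact metric space $X$ such that for every $a\in[\alpha,\beta]$ the $\mathbf{k}$-vector space $H_k(\mathrm{Rips}(X,a))$ has uncountable (infinite) dimension. -/

import Mathlib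

noncomputable section

namespace AbstractSimplicialComplex

universe u w

variable {V : Type u} (K : AbstractSimplicialComplex V) (R : Type w) [CommRing R]

/-- An `n`-simplex of `K` with an ordering of its vertices, repetitions allowed: a tuple
`(v₀, …, vₙ)` of vertices whose underlying set `{v₀, …, vₙ}` is a face of `K`. -/
def OrderedSimplex (n : ℕ) : Type u :=
  {v : Fin (n + 1) → V // (Set.finite_range v).toFinset ∈ K.faces}

variable {K} in
/-- Any tuple of vertices of an ordered simplex is again an ordered simplex. -/
def OrderedSimplex.comp {m n : ℕ} (v : K.OrderedSimplex n) (f : Fin (m + 1) → Fin (n + 1)) :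
    K.OrderedSimplex m :=
  ⟨v.1 ∘ f, by
    refine (K.isRelLowerSet_faces v.2).2 ?_ ?_
    · intro x hx
      simp only [Set.Finite.mem_toFinset, Set.mem_range, Function.comp_apply] at hx ⊢
      obtain ⟨y, rfl⟩ := hx
      exact ⟨_, rfl⟩
    · exact ⟨v.1 (f 0), by simp⟩⟩

variable {K} in
/-- The `i`-th face `(v₀, …, v̂ᵢ, …, vₙ₊₁)`, obtained by omitting the vertex `vᵢ`. -/
def OrderedSimplex.face {n : ℕ} (v : K.OrderedSimplex (n + 1)) (i : Fin (n + 2)) :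
    K.OrderedSimplex n :=
  v.comp i.succAbove

/-- The relations between ordered simplices which define oriented simplices:
a tuple with a repeated vertex is zero, and
`(v_{π 0}, …, v_{π n}) = sign π • (v₀, …, vₙ)` for every permutation `π`. -/
def orientationRelations (n : ℕ) : Submodule R (K.OrderedSimplex n →₀ R) :=
  Submodule.span R
    ({c | ∃ v : K.OrderedSimplex n, ¬ Function.Injective v.1 ∧ c = Finsupp.single v 1} ∪
     {c | ∃ (v : K.OrderedSimplex n) (π : Equiv.Perm (Fin (n + 1))),
        c = Finsupp.single (v.comp π) 1 -
          ((Equiv.Perm.sign π : ℤˣ) : ℤ) • Finsupp.single v 1})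

/-- The module `Cₙ(K; R)` of oriented simplicial `n`-chains. It is free on the `n`-dimensional
faces of `K`, once an orientation of each of these has been chosen. -/
abbrev OrientedChain (n : ℕ) : Type (max u w) :=
  (K.OrderedSimplex n →₀ R) ⧸ K.orientationRelations R n

/-- The boundary on ordered simplices:
`∂ (v₀, …, vₙ₊₁) = ∑ i, (-1) ^ i • (v₀, …, v̂ᵢ, …, vₙ₊₁)`. -/
def orderedBoundary (n : ℕ) : (K.OrderedSimplex (n + 1) →₀ R) →ₗ[R] (K.OrderedSimplex n →₀ R) :=
  Finsupp.linearCombination R fun v =>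
    ∑ i : Fin (n + 2), ((-1 : ℤ) ^ (i : ℕ)) • Finsupp.single (v.face i) (1 : R)

/-- A permutation `π` of the vertices of a simplex induces a permutation of the vertices of each
of its faces. -/
theorem exists_perm_face {n : ℕ} (π : Equiv.Perm (Fin (n + 2))) (l : Fin (n + 2)) :
    ∃ ρ : Equiv.Perm (Fin (n + 1)),
      (∀ j, π (l.succAbove j) = (π l).succAbove (ρ j)) ∧
      ((-1 : ℤ) ^ (l : ℕ)) * ((Equiv.Perm.sign ρ : ℤˣ) : ℤ) =
        ((Equiv.Perm.sign π : ℤˣ) : ℤ) * (-1 : ℤ) ^ ((π l : Fin (n + 2)) : ℕ) := by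
  set σ : Equiv.Perm (Fin (n + 2)) := l.cycleRange.symm.trans (π.trans (π l).cycleRange) with hσ
  obtain ⟨⟨p, ρ⟩, hp⟩ := Equiv.Perm.decomposeFin.symm.surjective σ
  have hσ0 : σ 0 = 0 := by simp [hσ, Fin.cycleRange_symm_zero]
  have hp0 : p = 0 := by rw [← hp] at hσ0; simpa using hσ0
  subst hp0
  refine ⟨ρ, fun j => ?_, ?_⟩
  · have h1 : σ j.succ = (ρ j).succ := by rw [← hp]; simp
    simp only [hσ, Equiv.trans_apply, Fin.cycleRange_symm_succ] at h1
    rw [← Equiv.eq_symm_apply, Fin.cycleRange_symm_succ] at h1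
    exact h1
  · have h2 : Equiv.Perm.sign σ = Equiv.Perm.sign ρ := by
      rw [← hp, Equiv.Perm.decomposeFin.symm_sign]; simp
    rw [← h2, hσ]
    simp only [Equiv.Perm.sign_trans, Equiv.Perm.sign_symm, Fin.sign_cycleRange]
    push_cast
    have h3 : ((-1 : ℤ) ^ (l : ℕ)) * (-1) ^ (l : ℕ) = 1 := by
      rw [← mul_pow]; simp
    linear_combination
      ((-1 : ℤ) ^ ((π l : Fin (n + 2)) : ℕ) * ((Equiv.Perm.sign π : ℤˣ) : ℤ)) * h3

theorem single_mem_orientationRelations {n : ℕ} (v : K.OrderedSimplex n)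
    (hv : ¬ Function.Injective v.1) : Finsupp.single v 1 ∈ K.orientationRelations R n :=
  Submodule.subset_span (Or.inl ⟨v, hv, rfl⟩)

theorem single_comp_sub_mem_orientationRelations {n : ℕ} (v : K.OrderedSimplex n)
    (π : Equiv.Perm (Fin (n + 1))) :
    Finsupp.single (v.comp π) 1 - ((Equiv.Perm.sign π : ℤˣ) : ℤ) • Finsupp.single v 1 ∈
      K.orientationRelations R n :=
  Submodule.subset_span (Or.inr ⟨v, π, rfl⟩)

/-- The class `[v₀, …, vₙ]` of an ordered simplex in the module of oriented chains. -/
def orientedSimplex {n : ℕ} (v : K.OrderedSimplex n) : K.OrientedChain R n :=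
  (K.orientationRelations R n).mkQ (Finsupp.single v 1)

theorem orientedSimplex_eq_zero {n : ℕ} (v : K.OrderedSimplex n)
    (hv : ¬ Function.Injective v.1) : K.orientedSimplex R v = 0 :=
  (Submodule.Quotient.mk_eq_zero _).2 (K.single_mem_orientationRelations R v hv)

theorem orientedSimplex_comp {n : ℕ} (v : K.OrderedSimplex n) (π : Equiv.Perm (Fin (n + 1))) :
    K.orientedSimplex R (v.comp π) =
      ((Equiv.Perm.sign π : ℤˣ) : ℤ) • K.orientedSimplex R v := by
  have h := (Submodule.Quotient.eq _).2 (K.single_comp_sub_mem_orientationRelations R v π)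
  rw [orientedSimplex, orientedSimplex, ← map_zsmul]
  exact h

theorem mkQ_orderedBoundary_single {n : ℕ} (v : K.OrderedSimplex (n + 1)) :
    (K.orientationRelations R n).mkQ (K.orderedBoundary R n (Finsupp.single v 1)) =
      ∑ i : Fin (n + 2), ((-1 : ℤ) ^ (i : ℕ)) • K.orientedSimplex R (v.face i) := by
  rw [orderedBoundary, Finsupp.linearCombination_single, one_smul, map_sum]
  simp only [map_zsmul, orientedSimplex]

theorem orientedSimplex_face_comp {n : ℕ} (v : K.OrderedSimplex (n + 1))
    (π : Equiv.Perm (Fin (n + 2))) (l : Fin (n + 2)) :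
    ((-1 : ℤ) ^ (l : ℕ)) • K.orientedSimplex R ((v.comp π).face l) =
      (((Equiv.Perm.sign π : ℤˣ) : ℤ) * (-1 : ℤ) ^ ((π l : Fin (n + 2)) : ℕ)) •
        K.orientedSimplex R (v.face (π l)) := by
  obtain ⟨ρ, h1, h2⟩ := exists_perm_face π l
  have h3 : (v.comp π).face l = (v.face (π l)).comp ρ := by
    apply Subtype.ext
    funext j
    exact congrArg v.1 (h1 j)
  rw [h3, orientedSimplex_comp, smul_smul, h2]

theorem orientationRelations_le_comap (n : ℕ) :
    K.orientationRelations R (n + 1) ≤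
      (K.orientationRelations R n).comap (K.orderedBoundary R n) := by
  rw [orientationRelations, Submodule.span_le]
  rintro c (⟨v, hv, rfl⟩ | ⟨v, π, rfl⟩)
  · rw [SetLike.mem_coe, Submodule.mem_comap, ← Submodule.Quotient.mk_eq_zero,
      ← Submodule.mkQ_apply, mkQ_orderedBoundary_single]
    simp only [Function.Injective, not_forall] at hv
    obtain ⟨a, b, hab, hne⟩ := hv
    have hz : ∀ l, l ≠ a → l ≠ b → K.orientedSimplex R (v.face l) = 0 := by
      intro l hla hlb
      apply orientedSimplex_eq_zero
      intro hinj
      obtain ⟨a', rfl⟩ := Fin.exists_succAbove_eq (Ne.symm hla)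
      obtain ⟨b', rfl⟩ := Fin.exists_succAbove_eq (Ne.symm hlb)
      exact hne (congrArg _ (hinj hab))
    rw [Finset.sum_eq_add a b hne (fun l _ hl => by rw [hz l hl.1 hl.2, smul_zero])
      (fun h => absurd (Finset.mem_univ _) h) (fun h => absurd (Finset.mem_univ _) h)]
    have hsw : v.comp (Equiv.swap a b) = v := by
      apply Subtype.ext
      funext j
      show v.1 (Equiv.swap a b j) = v.1 j
      rw [Equiv.swap_apply_def]
      split_ifs with h h'
      · rw [h, hab]
      · rw [h', hab]
      · rfl
    have h := K.orientedSimplex_face_comp R v (Equiv.swap a b) a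
    rw [hsw, Equiv.Perm.sign_swap hne, Equiv.swap_apply_left] at h
    rw [h]
    simp
  · rw [SetLike.mem_coe, Submodule.mem_comap, ← Submodule.Quotient.mk_eq_zero,
      ← Submodule.mkQ_apply, map_sub, map_sub, map_zsmul, map_zsmul,
      mkQ_orderedBoundary_single, mkQ_orderedBoundary_single, sub_eq_zero]
    simp only [orientedSimplex_face_comp, Finset.smul_sum, smul_smul]
    exact Equiv.sum_comp π fun l : Fin (n + 2) =>
      (((Equiv.Perm.sign π : ℤˣ) : ℤ) * (-1 : ℤ) ^ (l : ℕ)) • K.orientedSimplex R (v.face l)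

/-- The boundary operator `∂ : Cₙ₊₁(K; R) → Cₙ(K; R)` on oriented chains,
`∂ [v₀, …, vₙ₊₁] = ∑ i, (-1) ^ i • [v₀, …, v̂ᵢ, …, vₙ₊₁]`. -/
def boundary (n : ℕ) : K.OrientedChain R (n + 1) →ₗ[R] K.OrientedChain R n :=
  Submodule.mapQ _ _ (K.orderedBoundary R n) (K.orientationRelations_le_comap R n)

theorem boundary_orientedSimplex {n : ℕ} (v : K.OrderedSimplex (n + 1)) :
    K.boundary R n (K.orientedSimplex R v) =
      ∑ i : Fin (n + 2), ((-1 : ℤ) ^ (i : ℕ)) • K.orientedSimplex R (v.face i) :=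
  K.mkQ_orderedBoundary_single R v

theorem boundary_comp_boundary (n : ℕ) : K.boundary R n ∘ₗ K.boundary R (n + 1) = 0 := by
  apply Submodule.linearMap_qext
  apply Finsupp.lhom_ext'
  intro v
  apply LinearMap.ext_ring
  show K.boundary R n (K.boundary R (n + 1) (K.orientedSimplex R v)) = 0
  rw [boundary_orientedSimplex, map_sum]
  simp only [map_zsmul, boundary_orientedSimplex, Finset.smul_sum, smul_smul]
  rw [← Finset.sum_product', Finset.univ_product_univ]
  refine Finset.sum_involution
    (fun p _ => (p.1.succAbove p.2, p.2.predAbove p.1)) ?_ ?_ ?_ ?_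
  · rintro ⟨i, j⟩ -
    have hf : (v.face i).face j = (v.face (i.succAbove j)).face (j.predAbove i) := by
      apply Subtype.ext
      funext l
      exact congrArg v.1 (Fin.succAbove_succAbove_succAbove_predAbove i j l).symm
    show ((-1 : ℤ) ^ (i : ℕ) * (-1) ^ (j : ℕ)) • _ +
      ((-1 : ℤ) ^ ((i.succAbove j : Fin _) : ℕ) * (-1) ^ ((j.predAbove i : Fin _) : ℕ)) • _ = 0
    rw [hf, ← add_smul, ← pow_add, ← pow_add, Fin.neg_one_pow_succAbove_add_predAbove,
      add_neg_cancel, zero_smul]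
  · rintro ⟨i, j⟩ - - h
    exact Fin.succAbove_ne i j (congrArg Prod.fst h)
  · rintro ⟨i, j⟩ -
    exact Finset.mem_univ _
  · rintro ⟨i, j⟩ -
    exact Prod.ext (Fin.succAbove_succAbove_predAbove i j) (Fin.predAbove_predAbove_succAbove i j)

/-- The oriented simplicial chain complex of `K` with coefficients in `R`. -/
def simplicialChainComplex : ChainComplex (ModuleCat.{max u w} R) ℕ :=
  ChainComplex.of (fun n => ModuleCat.of R (K.OrientedChain R n))
    (fun n => ModuleCat.ofHom (K.boundary R n))
    (fun n => by
      rw [← ModuleCat.ofHom_comp, boundary_comp_boundary]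
      rfl)

/-- The simplicial homology `Hₙ(K; R)`. -/
def simplicialHomology (n : ℕ) : ModuleCat.{max u w} R :=
  (K.simplicialChainComplex R).homology n

end AbstractSimplicialComplex

/-- The Vietoris--Rips complex `Rips(X, a)`: the simplicial complex with vertex set `X` whose
simplices are the nonempty finite subsets of `X` whose distinct points are at distance at most `a`
from each other. -/
def Rips (X : Type*) [MetricSpace X] (a : ℝ) : AbstractSimplicialComplex X where
  faces := {s | s.Nonempty ∧ ∀ x ∈ s, ∀ y ∈ s, x ≠ y → dist x y ≤ a}
  isRelLowerSet_faces := fun _ hs =>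
    ⟨hs.1, fun _ hts ht => ⟨ht, fun _ hx _ hy => hs.2 _ (hts hx) _ (hts hy)⟩⟩
  singleton_mem v := ⟨Finset.singleton_nonempty v, fun _ hx _ hy hxy =>
    absurd ((Finset.mem_singleton.1 hx).trans (Finset.mem_singleton.1 hy).symm) hxy⟩

end

/-! A cycle in which a maximal simplex has coefficient one is nonzero in homology, because the
cochain dual to a maximal simplex is a cocycle and detects it. The cycles used are fundamental
cycles of k-spheres triangulated as boundaries of (k+1)-dimensional cross-polytopes, one for each s
in (0, 1]. The positive facet of each is maximal in the Rips complex and has a vertex lying in no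
other member of the family, so cycles and cocycles are dual to each other and the classes are
independent (`exists_linearIndependent_rips_simplicialHomology`).

At scale one such a family lives in a compact subset `base` of the unit ball of a sup-normed space.
To serve all scales in [α, β] with a single space, take the truncated cone whose slice at height a
is `base` rescaled by a. Its metric charges enough for a change of height that points off the slice
cannot enlarge the positive facets (`exists_conePoint_vertex_true_eq`). -/

open CategoryTheory

namespace AbstractSimplicialComplex

universe u w

/-! ### Cochains dual to oriented simplices. -/

section Cochain

variable {V : Type u} (K : AbstractSimplicialComplex V) (R : Type w) [CommRing R]

open Classical in
/-- The matrix comparing two tuples of vertices entry by entry. -/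
noncomputable def incidenceMatrix {n : ℕ} (σ v : Fin n → V) : Matrix (Fin n) (Fin n) R :=
  Matrix.of fun i j => if v i = σ j then 1 else 0

theorem det_incidenceMatrix_self {n : ℕ} {σ : Fin n → V} (hσ : Function.Injective σ) :
    (incidenceMatrix R σ σ).det = 1 := by
  have : incidenceMatrix R σ σ = 1 := by
    ext i j
    simp [incidenceMatrix, Matrix.one_apply, hσ.eq_iff]
  rw [this, Matrix.det_one]

theorem det_incidenceMatrix_eq_zero_of_notMem_range {n : ℕ} {σ v : Fin n → V} (j : Fin n)
    (hj : σ j ∉ Set.range v) : (incidenceMatrix R σ v).det = 0 :=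
  Matrix.det_eq_zero_of_column_eq_zero j fun i => by
    rw [incidenceMatrix, Matrix.of_apply, if_neg fun h => hj ⟨i, h⟩]

theorem det_incidenceMatrix_eq_zero_of_not_injective {n : ℕ} {σ v : Fin n → V}
    (hv : ¬ Function.Injective v) : (incidenceMatrix R σ v).det = 0 := by
  simp only [Function.Injective, not_forall] at hv
  obtain ⟨a, b, hab, hne⟩ := hv
  exact Matrix.det_zero_of_row_eq hne (by ext j; rw [incidenceMatrix, Matrix.of_apply, Matrix.of_apply]; congr 1; rw [hab])

theorem det_incidenceMatrix_comp_perm {n : ℕ} (σ v : Fin n → V) (π : Equiv.Perm (Fin n)) :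
    (incidenceMatrix R σ (v ∘ π)).det =
      ((Equiv.Perm.sign π : ℤˣ) : ℤ) • (incidenceMatrix R σ v).det := by
  rw [zsmul_eq_mul, ← Matrix.det_permute π]
  rfl

/-- The cochain dual to an oriented simplex `[σ₀, …, σₙ]`. -/
noncomputable def dualCochain {n : ℕ} (σ : Fin (n + 1) → V) : K.OrientedChain R n →ₗ[R] R :=
  -- For injective `σ` the determinant is the sign of the permutation if `v` rearranges `σ`, and
  -- zero otherwise. Being alternating in the rows, it respects the orientation relations.
  (K.orientationRelations R n).liftQ
    (Finsupp.linearCombination R fun v : K.OrderedSimplex n => (incidenceMatrix R σ v.1).det) <| by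
    rw [orientationRelations, Submodule.span_le]
    rintro c (⟨v, hv, rfl⟩ | ⟨v, π, rfl⟩)
    · simp [det_incidenceMatrix_eq_zero_of_not_injective R hv]
    · have h : (incidenceMatrix R σ (v.comp π).1).det = _ :=
        det_incidenceMatrix_comp_perm R σ v.1 π
      rw [SetLike.mem_coe, LinearMap.mem_ker, map_sub, map_zsmul,
        Finsupp.linearCombination_single, Finsupp.linearCombination_single, one_smul, one_smul, h,
        sub_self]

theorem dualCochain_orientedSimplex {n : ℕ} (σ : Fin (n + 1) → V) (v : K.OrderedSimplex n) :
    K.dualCochain R σ (K.orientedSimplex R v) = (incidenceMatrix R σ v.1).det := by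
  simp [dualCochain, orientedSimplex]

/-- Linear maps on oriented chains agree if they agree on oriented simplices. -/
theorem orientedChain_hom_ext {n : ℕ} {M : Type*} [AddCommGroup M] [Module R M]
    {f g : K.OrientedChain R n →ₗ[R] M}
    (h : ∀ v, f (K.orientedSimplex R v) = g (K.orientedSimplex R v)) : f = g := by
  apply Submodule.linearMap_qext
  apply Finsupp.lhom_ext'
  intro v
  apply LinearMap.ext_ring
  exact h v

/-- The cochain dual to a maximal simplex is a cocycle. -/
theorem dualCochain_comp_boundary {n : ℕ} {σ : Fin (n + 1) → V}
    (hσ : ∀ s ∈ K.faces, Set.range σ ⊆ s → (s : Set V) ⊆ Set.range σ) :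
    K.dualCochain R σ ∘ₗ K.boundary R n = 0 := by
  refine K.orientedChain_hom_ext R fun w => ?_
  rw [LinearMap.comp_apply, LinearMap.zero_apply]
  by_cases hw : Set.range σ ⊆ Set.range w.1
  · have hle : Set.range w.1 ⊆ Set.range σ := by
      simpa using hσ _ w.2 (by simpa using hw)
    -- By maximality the n + 2 entries of `w` lie among the n + 1 entries of `σ`, so one is
    -- repeated.
    rw [K.orientedSimplex_eq_zero R w, map_zero, map_zero]
    intro hinj
    choose f hf using fun i => hle ⟨i, rfl⟩
    have hfi : Function.Injective f := fun i j hij => hinj (by rw [← hf i, ← hf j, hij])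
    simpa using Fintype.card_le_of_injective f hfi
  · simp only [Set.range_subset_iff, not_forall] at hw
    obtain ⟨j, hj⟩ := hw
    rw [boundary_orientedSimplex, map_sum]
    refine Finset.sum_eq_zero fun i _ => ?_
    rw [map_zsmul, dualCochain_orientedSimplex,
      det_incidenceMatrix_eq_zero_of_notMem_range R j, smul_zero]
    rintro ⟨l, hl⟩
    exact hj ⟨_, hl⟩

end Cochain

/-! ### Fundamental cycles of cross-polytopes. -/

section CrossPolytope

variable {V : Type u} (K : AbstractSimplicialComplex V) (R : Type w) [CommRing R]

/-- The vertex tuples of the facets of the cross-polytope with pairs of opposite vertices `P i`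
are simplices of `K`. -/
def HasCrossPolytope {n : ℕ} (P : Fin (n + 1) → Bool → V) : Prop :=
  ∀ ε : Fin (n + 1) → Bool, (Set.finite_range fun i => P i (ε i)).toFinset ∈ K.faces

variable {K}

/-- The facet of a cross-polytope selecting one vertex of every pair of opposite vertices. -/
def HasCrossPolytope.facet {n : ℕ} {P : Fin (n + 1) → Bool → V} (hP : K.HasCrossPolytope P)
    (ε : Fin (n + 1) → Bool) : K.OrderedSimplex n :=
  ⟨fun i => P i (ε i), hP ε⟩

/-- The fundamental chain of a cross-polytope. -/
noncomputable def HasCrossPolytope.chain {n : ℕ} {P : Fin (n + 1) → Bool → V}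
    (hP : K.HasCrossPolytope P) : K.OrientedChain R n :=
  ∑ ε : Fin (n + 1) → Bool, (∏ i, if ε i then (1 : ℤ) else -1) • K.orientedSimplex R (hP.facet ε)

/-- Switching the choice in the `l`-th pair leaves the face omitting the `l`-th vertex unchanged and
reverses the sign of the facet, so the faces cancel in pairs. -/
theorem HasCrossPolytope.boundary_chain {n : ℕ} {P : Fin (n + 2) → Bool → V}
    (hP : K.HasCrossPolytope P) : K.boundary R n (hP.chain R) = 0 := by
  simp only [chain, map_sum, map_zsmul, boundary_orientedSimplex, Finset.smul_sum]
  rw [Finset.sum_comm]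
  refine Finset.sum_eq_zero fun l _ => ?_
  refine Finset.sum_involution (fun ε _ => Function.update ε l (!ε l)) ?_ ?_ ?_ ?_
  · intro ε _
    have hface : (hP.facet (Function.update ε l (!ε l))).face l = (hP.facet ε).face l := by
      apply Subtype.ext
      funext j
      exact congrArg (P (l.succAbove j)) (Function.update_of_ne (Fin.succAbove_ne l j) _ _)
    have hsign : (∏ i, if Function.update ε l (!ε l) i then (1 : ℤ) else -1) =
        -∏ i, if ε i then (1 : ℤ) else -1 := by
      rw [Fin.prod_univ_succAbove _ l, Fin.prod_univ_succAbove _ l, ← neg_mul]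
      simp only [Function.update_self, Function.update_of_ne (Fin.succAbove_ne l _)]
      cases ε l <;> simp
    rw [hface, hsign, neg_smul, add_neg_cancel]
  · intro ε _ _ h
    have := congrFun h l
    simp at this
  · intro ε _
    exact Finset.mem_univ _
  · intro ε _
    simp

/-- The dual cochain of the positive facet of a cross-polytope takes the value one on it. -/
theorem HasCrossPolytope.dualCochain_chain_self {n : ℕ} {P : Fin (n + 1) → Bool → V}
    (hP : K.HasCrossPolytope P) (hinj : ∀ i j b, P j b = P i true → j = i ∧ b = true) :
    K.dualCochain R (fun i => P i true) (hP.chain R) = 1 := by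
  rw [chain, map_sum, Finset.sum_eq_single (fun _ => true)]
  · have h : Function.Injective fun i => P i true := fun i j hij => (hinj j i true hij).1
    rw [map_zsmul, dualCochain_orientedSimplex]
    simp [facet, det_incidenceMatrix_self R h]
  · intro ε _ hε
    obtain ⟨j, hj⟩ := Function.ne_iff.1 hε
    rw [map_zsmul, dualCochain_orientedSimplex,
      det_incidenceMatrix_eq_zero_of_notMem_range R j, smul_zero]
    rintro ⟨i, hi⟩
    obtain ⟨rfl, h⟩ := hinj _ _ _ hi
    exact hj h
  · exact fun h => absurd (Finset.mem_univ _) h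

theorem HasCrossPolytope.dualCochain_chain_eq_zero {n : ℕ} {P : Fin (n + 1) → Bool → V}
    (hP : K.HasCrossPolytope P) {σ : Fin (n + 1) → V} (i : Fin (n + 1))
    (h : ∀ j b, P j b ≠ σ i) : K.dualCochain R σ (hP.chain R) = 0 := by
  rw [chain, map_sum]
  refine Finset.sum_eq_zero fun ε _ => ?_
  rw [map_zsmul, dualCochain_orientedSimplex,
    det_incidenceMatrix_eq_zero_of_notMem_range R i, smul_zero]
  rintro ⟨j, hj⟩
  exact h _ _ hj

end CrossPolytope

/-! ### Independence in homology by duality. -/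

section Homology

/-- A family of cycles that is dual to a family of cocycles is independent in homology. -/
theorem exists_linearIndependent_simplicialHomology {V : Type} (K : AbstractSimplicialComplex V)
    (R : Type w) [CommRing R] {n : ℕ} {ι : Type*} (z : ι → K.OrientedChain R (n + 1))
    (φ : ι → K.OrientedChain R (n + 1) →ₗ[R] R) (hz : ∀ i, K.boundary R n (z i) = 0)
    (hφ : ∀ i, φ i ∘ₗ K.boundary R (n + 1) = 0) (hone : ∀ i, φ i (z i) = 1)
    (hzero : ∀ i j, i ≠ j → φ i (z j) = 0) :
    ∃ x : ι → K.simplicialHomology R (n + 1), LinearIndependent R x := by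
  let C := K.simplicialChainComplex R
  have hd (m : ℕ) : C.d (m + 1) m = ModuleCat.ofHom (K.boundary R m) :=
    ChainComplex.of_d (fun m => ModuleCat.of R (K.OrientedChain R m)) (fun m => ModuleCat.ofHom (K.boundary R m)) m
  -- With cycles as maps out of `R` and cocycles as maps into `R`, the universal properties of
  -- cycles and opcycles yield homology classes and functionals on homology.
  let zc (i : ι) : ModuleCat.of R R ⟶ C.X (n + 1) :=
    ModuleCat.ofHom (LinearMap.toSpanSingleton R (K.OrientedChain R (n + 1)) (z i))
  let φc (i : ι) : C.X (n + 1) ⟶ ModuleCat.of R R := ModuleCat.ofHom (φ i)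
  have hzc (i : ι) : zc i ≫ C.d (n + 1) n = 0 := by
    rw [hd]
    ext
    change K.boundary R n ((1 : R) • z i) = 0
    rw [one_smul, hz]
  have hφc (i : ι) : C.d (n + 2) (n + 1) ≫ φc i = 0 := by
    rw [hd]
    exact ModuleCat.hom_ext (hφ i)
  let f (i : ι) : ModuleCat.of R R ⟶ C.homology (n + 1) :=
    C.liftCycles (zc i) n (by simp) (hzc i) ≫ C.homologyπ (n + 1)
  let g (i : ι) : C.homology (n + 1) ⟶ ModuleCat.of R R :=
    C.homologyι (n + 1) ≫ C.descOpcycles (φc i) (n + 2) (by simp) (hφc i)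
  have hfg (i j : ι) : f j ≫ g i = zc j ≫ φc i := by
    simp [f, g]
  have hval (i j : ι) : (g i).hom ((f j).hom (1 : R)) = φ i (z j) := by
    have h := congrArg (fun e : ModuleCat.of R R ⟶ ModuleCat.of R R => e.hom (1 : R)) (hfg i j)
    refine h.trans ?_
    change φ i ((1 : R) • z j) = _
    rw [one_smul]
  exact ⟨fun i => (f i).hom (1 : R),
    LinearIndependent.of_pairwise_dual_eq_zero_one _ (fun i => (g i).hom)
      (fun i j hij => (hval i j).trans (hzero i j hij)) (fun i => (hval i i).trans (hone i))⟩

end Homology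

end AbstractSimplicialComplex

/-! ### Cross-polytopes in Rips complexes. -/

/-- A tuple of points at mutual distance at most `a` spans a simplex of the Rips complex. -/
theorem finite_range_mem_rips_faces {X : Type*} [MetricSpace X] {a : ℝ} {n : ℕ}
    {v : Fin (n + 1) → X} (hv : ∀ i j, i ≠ j → dist (v i) (v j) ≤ a) :
    (Set.finite_range v).toFinset ∈ (Rips X a).faces := by
  refine ⟨⟨v 0, by simp⟩, ?_⟩
  simp only [Set.Finite.mem_toFinset, Set.mem_range]
  rintro _ ⟨i, rfl⟩ _ ⟨j, rfl⟩ hij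
  exact hv i j fun h => hij (by rw [h])

/-- A tuple of points containing all its common neighbours spans a maximal Rips simplex. -/
theorem rips_face_subset_range {X : Type*} [MetricSpace X] {a : ℝ} {n : ℕ} {v : Fin n → X}
    (hv : ∀ x, (∀ i, dist x (v i) ≤ a) → x ∈ Set.range v) :
    ∀ s ∈ (Rips X a).faces, Set.range v ⊆ s → (s : Set X) ⊆ Set.range v := by
  intro s hs hvs x hx
  by_contra hxv
  refine hxv (hv x fun i => hs.2 x hx _ (hvs ⟨i, rfl⟩) ?_)
  rintro rfl
  exact hxv ⟨i, rfl⟩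

/-- A family of cross-polytopes in a Rips complex, each having a maximal facet with a vertex that
is contained in no other member of the family, is independent in homology. -/
theorem exists_linearIndependent_rips_simplicialHomology {X : Type} [MetricSpace X] {a : ℝ}
    (R : Type*) [CommRing R] {n : ℕ} {ι : Type*} (P : ι → Fin (n + 2) → Bool → X)
    (hadj : ∀ s i j b c, i ≠ j → dist (P s i b) (P s j c) ≤ a)
    (hmax : ∀ s x, (∀ i, dist x (P s i true) ≤ a) → ∃ i, P s i true = x)
    (hinj : ∀ s i j b, P s j b = P s i true → j = i ∧ b = true)
    (hsep : ∀ s t j b, P s j b = P t 0 true → s = t) :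
    ∃ x : ι → (Rips X a).simplicialHomology R (n + 1), LinearIndependent R x := by
  have hP (s : ι) : (Rips X a).HasCrossPolytope (P s) := fun ε =>
    finite_range_mem_rips_faces fun i j hij => hadj s i j _ _ hij
  refine (Rips X a).exists_linearIndependent_simplicialHomology R (fun s => (hP s).chain R)
    (fun s => (Rips X a).dualCochain R fun i => P s i true) (fun s => (hP s).boundary_chain R)
    (fun s => (Rips X a).dualCochain_comp_boundary R (rips_face_subset_range (hmax s)))
    (fun s => (hP s).dualCochain_chain_self R (hinj s)) fun s t hst =>
    (hP t).dualCochain_chain_eq_zero R 0 fun j b h => hst (hsep t s j b h).symm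

/-! ### The base: a one-parameter family of cross-polytopes at scale one. -/

namespace CrossPolytopeCone

/-- The normed space containing the base of the cone. -/
abbrev Ambient (m : ℕ) : Type := ℝ × ℝ × (Fin m → ℝ)

/-- The pairs of opposite vertices of a cross-polytope depending on a parameter. -/
def vertex {m : ℕ} (s : ℝ) : Fin (m + 2) → Bool → Ambient m :=
  -- Put A_t = (t - 1, -t) and B_t = (t, 1 - t), on two parallel segments. The vertices opposite to
  -- A_s and B_s are B_0 and A_0, which gives a 4-cycle; each remaining coordinate suspends it.
  Fin.cons (fun b => if b then (s - 1, -s, 0) else (0, 1, 0)) <|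
    Fin.cons (fun b => if b then (s, 1 - s, 0) else (-1, 0, 0)) fun i b =>
      (0, 0, Pi.single i (if b then 1 else -1))

section

variable {m : ℕ} (s : ℝ)

@[simp] theorem vertex_zero_true : vertex (m := m) s 0 true = (s - 1, -s, 0) := rfl
@[simp] theorem vertex_zero_false : vertex (m := m) s 0 false = (0, 1, 0) := rfl
@[simp] theorem vertex_one_true : vertex (m := m) s 1 true = (s, 1 - s, 0) := rfl
@[simp] theorem vertex_one_false : vertex (m := m) s 1 false = (-1, 0, 0) := rfl
@[simp] theorem vertex_succ_succ (i : Fin m) (b : Bool) :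
    vertex s i.succ.succ b = (0, 0, Pi.single i (if b then 1 else -1)) := rfl

end

/-- The base of the cone: all vertices of the cross-polytopes with parameter in `[0, 1]`. -/
def base (m : ℕ) : Set (Ambient m) :=
  {y | ∃ s ∈ Set.Icc (0 : ℝ) 1, ∃ i b, vertex s i b = y}

theorem continuous_vertex {m : ℕ} (i : Fin (m + 2)) (b : Bool) :
    Continuous fun s => vertex s i b := by
  cases i using Fin.cases with
  | zero => cases b <;> simp only [vertex_zero_true, vertex_zero_false] <;> fun_prop
  | succ i =>
    cases i using Fin.cases with
    | zero => cases b <;> simp only [Fin.succ_zero_eq_one, vertex_one_true, vertex_one_false] <;> fun_prop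
    | succ i => simp only [vertex_succ_succ]; fun_prop

theorem isCompact_base (m : ℕ) : IsCompact (base m) := by
  have h : base m = ⋃ (i : Fin (m + 2)) (b : Bool), (fun s => vertex s i b) '' Set.Icc 0 1 := by
    ext y
    simp only [base, Set.mem_ofPred_eq, Set.mem_iUnion, Set.mem_image]
    exact ⟨fun ⟨s, hs, i, b, h⟩ => ⟨i, b, s, hs, h⟩, fun ⟨i, b, s, hs, h⟩ => ⟨s, hs, i, b, h⟩⟩
  rw [h]
  exact isCompact_iUnion fun i => isCompact_iUnion fun b =>
    isCompact_Icc.image (continuous_vertex i b)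

theorem norm_le_one_of_mem_base {m : ℕ} {y : Ambient m} (hy : y ∈ base m) : ‖y‖ ≤ 1 := by
  obtain ⟨s, ⟨h0, h1⟩, i, b, rfl⟩ := hy
  cases i using Fin.cases with
  | zero =>
    cases b <;> simp [Prod.norm_def, abs_le] <;> (repeat' constructor) <;> linarith
  | succ i =>
    cases i using Fin.cases with
    | zero =>
      cases b <;> simp [Prod.norm_def, abs_le] <;>
        (repeat' constructor) <;> linarith
    | succ i => cases b <;> simp [Prod.norm_def, Pi.norm_single]

theorem dist_single_single {m : ℕ} {i j : Fin m} (hij : i ≠ j) {r r' : ℝ} (hr : |r| = 1)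
    (hr' : |r'| = 1) : dist (Pi.single i r : Fin m → ℝ) (Pi.single j r') = 1 := by
  apply le_antisymm
  · rw [dist_pi_le_iff zero_le_one]
    intro l
    rw [Real.dist_eq]
    by_cases hi : l = i
    · subst hi; simp [hij, hr]
    · by_cases hj : l = j
      · subst hj; simp [hi, hr']
      · simp [hi, hj]
  · refine le_trans ?_ (dist_le_pi_dist _ _ i)
    simp [hij, hr]

theorem dist_vertex_le {m : ℕ} {s : ℝ} (hs : s ∈ Set.Icc (0 : ℝ) 1) {i j : Fin (m + 2)}
    (hij : i ≠ j) (b c : Bool) : dist (vertex s i b) (vertex s j c) ≤ 1 := by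
  obtain ⟨h0, h1⟩ := hs
  have h01 (b c : Bool) : dist (vertex (m := m) s 0 b) (vertex s 1 c) ≤ 1 := by
    cases b <;> cases c <;> simp [Prod.dist_eq, Real.dist_eq, abs_le] <;>
      (repeat' constructor) <;> linarith
  have h0i (b c : Bool) (i : Fin m) : dist (vertex (m := m) s 0 b) (vertex s i.succ.succ c) ≤ 1 := by
    cases b <;> cases c <;> simp [Prod.dist_eq, Pi.norm_single, abs_le] <;>
      (repeat' constructor) <;> linarith
  have h1i (b c : Bool) (i : Fin m) : dist (vertex (m := m) s 1 b) (vertex s i.succ.succ c) ≤ 1 := by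
    cases b <;> cases c <;> simp [Prod.dist_eq, Pi.norm_single, abs_le] <;>
      (repeat' constructor) <;> linarith
  cases i using Fin.cases with
  | zero =>
    cases j using Fin.cases with
    | zero => exact absurd rfl hij
    | succ j =>
      cases j using Fin.cases with
      | zero => exact h01 b c
      | succ j => exact h0i b c j
  | succ i =>
    cases i using Fin.cases with
    | zero =>
      cases j using Fin.cases with
      | zero => rw [dist_comm]; exact h01 c b
      | succ j =>
        cases j using Fin.cases with
        | zero => exact absurd rfl hij
        | succ j => exact h1i b c j
    | succ i =>
      cases j using Fin.cases with
      | zero => rw [dist_comm]; exact h0i c b i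
      | succ j =>
        cases j using Fin.cases with
        | zero => rw [dist_comm]; exact h1i c b i
        | succ j =>
          have hij' : i ≠ j := fun h => hij (by rw [h])
          simp only [vertex_succ_succ, Prod.dist_eq, dist_self]
          rw [dist_single_single hij' (by cases b <;> simp) (by cases c <;> simp)]
          simp

/-- This leaves no slack at a vertex of the positive facet, which later pins down the height in the
cone. -/
theorem exists_dist_vertex_true_eq_one {m : ℕ} (s : ℝ) (i : Fin (m + 2)) :
    ∃ j, 1 ≤ dist (vertex s i true) (vertex s j true) := by
  cases i using Fin.cases with
  | zero => exact ⟨1, by simp [Prod.dist_eq, Real.dist_eq]⟩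
  | succ i =>
    cases i using Fin.cases with
    | zero => exact ⟨0, by simp [Prod.dist_eq]⟩
    | succ i => exact ⟨0, by simp [Prod.dist_eq, Pi.norm_single]⟩

/-- The positive facets of the cross-polytopes are maximal simplices at scale one. -/
theorem exists_vertex_true_eq {m : ℕ} {s : ℝ} {y : Ambient m} (hy : y ∈ base m)
    (h : ∀ i, dist y (vertex s i true) ≤ 1) : ∃ i, vertex s i true = y := by
  obtain ⟨t, ⟨h0, h1⟩, i, b, rfl⟩ := hy
  have hd0 := h 0
  have hd1 := h 1
  cases i using Fin.cases with
  | zero =>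
    -- The difference A_t - B_s = (t - s - 1, s - t - 1) has both entries at least -1 only if t = s.
    -- The negative vertex of this pair is B_0, whence index 1 and the same argument with A_s.
    refine ⟨if b then 0 else 1, ?_⟩
    cases b <;> simp [Prod.dist_eq, Real.dist_eq, abs_le] at hd0 hd1 ⊢ <;> linarith
  | succ i =>
    cases i using Fin.cases with
    | zero =>
      refine ⟨if b then 1 else 0, ?_⟩
      cases b <;> simp [Prod.dist_eq, Real.dist_eq, abs_le] at hd0 hd1 ⊢ <;> linarith
    | succ i =>
      refine ⟨i.succ.succ, ?_⟩
      cases b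
      -- The `i`-th coordinates -1 and 1 are at distance two.
      · have := h i.succ.succ
        simp [Prod.dist_eq] at this
        have h2 := (dist_le_pi_dist _ _ i).trans this
        simp [Real.dist_eq] at h2
        norm_num at h2
      · rfl

/-- The parameter 0 has to be excluded: A_0 is a negative vertex of every cross-polytope. -/
theorem vertex_eq_vertex_zero_true {m : ℕ} {s t : ℝ} (hs : s ∈ Set.Ioc (0 : ℝ) 1)
    (ht : t ∈ Set.Ioc (0 : ℝ) 1) {j : Fin (m + 2)} {b : Bool}
    (h : vertex s j b = vertex t 0 true) : s = t ∧ j = 0 ∧ b = true := by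
  obtain ⟨h0, h1⟩ := hs
  obtain ⟨h0', h1'⟩ := ht
  cases j using Fin.cases with
  | zero =>
    cases b
    · simp at h; linarith
    · simp at h; simp [h]
  | succ j =>
    cases j using Fin.cases with
    | zero =>
      cases b <;> simp at h <;> linarith
    | succ j => simp at h; linarith

theorem vertex_eq_vertex_true {m : ℕ} {s : ℝ} (hs : s ∈ Set.Ioc (0 : ℝ) 1) {i j : Fin (m + 2)}
    {b : Bool} (h : vertex s j b = vertex s i true) : j = i ∧ b = true := by
  cases i using Fin.cases with
  | zero => exact (vertex_eq_vertex_zero_true hs hs h).2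
  | succ i =>
    obtain ⟨h0, h1⟩ := hs
    cases i using Fin.cases with
    | zero =>
      cases j using Fin.cases with
      | zero => cases b <;> simp at h <;> linarith
      | succ j =>
        cases j using Fin.cases with
        | zero =>
          cases b
          · simp at h; linarith
          · simp
        | succ j => simp at h; linarith
    | succ i =>
      cases j using Fin.cases with
      | zero => cases b <;> simp at h; linarith
      | succ j =>
        cases j using Fin.cases with
        | zero => cases b <;> simp at h; linarith
        | succ j =>
          simp only [vertex_succ_succ, Prod.mk.injEq, true_and] at h
          have h2 := congrFun h i
          by_cases hij : i = j
          · subst hij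
            cases b
            · simp at h2; norm_num at h2
            · simp
          · simp [hij] at h2

/-! ### The cone: all scales in one compact space. -/

/-- The point of the cone at height `c` over a point of the base. -/
def conePoint {m : ℕ} (c : ℝ) (y : Ambient m) : WithLp 1 (ℝ × Ambient m) :=
  -- Over the unit ball, changing the height by h moves `c • y` by at most h; the factor 2 pays for
  -- this and leaves a net cost of h.
  WithLp.toLp 1 (2 * c, c • y)

theorem dist_conePoint {m : ℕ} (c c' : ℝ) (y y' : Ambient m) :
    dist (conePoint c y) (conePoint c' y') = 2 * |c - c'| + dist (c • y) (c' • y') := by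
  rw [WithLp.prod_dist_eq_of_L1]
  change dist (2 * c) (2 * c') + _ = _
  rw [Real.dist_eq, ← mul_sub, abs_mul, abs_two]
  rfl

theorem dist_conePoint_self {m : ℕ} {a : ℝ} (ha : 0 < a) (y y' : Ambient m) :
    dist (conePoint a y) (conePoint a y') = a * dist y y' := by
  rw [dist_conePoint, dist_smul₀, Real.norm_of_nonneg ha.le]
  simp

/-- The part of the cone over the base with height in `[α, β]`. -/
def cone (m : ℕ) (α β : ℝ) : Set (WithLp 1 (ℝ × Ambient m)) :=
  (fun p : ℝ × Ambient m => conePoint p.1 p.2) '' (Set.Icc α β ×ˢ base m)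

theorem isCompact_cone (m : ℕ) (α β : ℝ) : IsCompact (cone m α β) := by
  refine (isCompact_Icc.prod (isCompact_base m)).image ?_
  unfold conePoint
  fun_prop

/-- The positive facets of the cross-polytopes at height `a` are maximal simplices at scale `a`. -/
theorem exists_conePoint_vertex_true_eq {m : ℕ} {a c s : ℝ} (ha : 0 < a) {y : Ambient m}
    (hy : y ∈ base m) (h : ∀ i, dist (conePoint c y) (conePoint a (vertex s i true)) ≤ a) :
    ∃ i, conePoint a (vertex s i true) = conePoint c y := by
  have key (i) : a * dist y (vertex s i true) ≤ a - |c - a| := by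
    have h1 := h i
    rw [dist_conePoint] at h1
    have h2 : dist (a • y) (c • y) ≤ |c - a| := by
      rw [dist_eq_norm, ← sub_smul, norm_smul, Real.norm_eq_abs, abs_sub_comm]
      exact mul_le_of_le_one_right (abs_nonneg _) (norm_le_one_of_mem_base hy)
    have h3 := dist_triangle (a • y) (c • y) (a • vertex s i true)
    rw [dist_smul₀, Real.norm_of_nonneg ha.le] at h3
    linarith
  obtain ⟨i, hi⟩ := exists_vertex_true_eq (s := s) hy fun i => by
    refine le_of_mul_le_mul_left ?_ ha
    linarith [key i, abs_nonneg (c - a)]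
  -- A facet vertex at base distance at least 1 turns `key` into a ≤ a - |c - a|.
  obtain ⟨j, hj⟩ := exists_dist_vertex_true_eq_one s i
  have hc : |c - a| ≤ 0 := by
    have h1 := key j
    rw [← hi] at h1
    have := mul_le_mul_of_nonneg_left hj ha.le
    linarith
  have hca : c = a := sub_eq_zero.1 (abs_nonpos_iff.1 hc)
  exact ⟨i, by rw [hi, hca]⟩

theorem conePoint_injective {m : ℕ} {a : ℝ} (ha : 0 < a) {y y' : Ambient m}
    (h : conePoint a y = conePoint a y') : y = y' := by
  rw [← dist_eq_zero, dist_conePoint_self ha] at h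
  exact dist_eq_zero.1 ((mul_eq_zero.1 h).resolve_left ha.ne')

theorem exists_linearIndependent_cone {m : ℕ} (R : Type*) [CommRing R] {α β a : ℝ} (hα : 0 < α)
    (ha : a ∈ Set.Icc α β) :
    ∃ x : Set.Ioc (0 : ℝ) 1 → (Rips (cone m α β) a).simplicialHomology R (m + 1),
      LinearIndependent R x := by
  have ha0 : 0 < a := hα.trans_le ha.1
  refine exists_linearIndependent_rips_simplicialHomology R
    (fun s i b => ⟨conePoint a (vertex s.1 i b), (a, vertex s.1 i b),
      ⟨ha, s.1, Set.Ioc_subset_Icc_self s.2, i, b, rfl⟩, rfl⟩) ?_ ?_ ?_ ?_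
  · intro s i j b c hij
    rw [Subtype.dist_eq, dist_conePoint_self ha0]
    exact mul_le_of_le_one_right ha0.le (dist_vertex_le (Set.Ioc_subset_Icc_self s.2) hij b c)
  · rintro s ⟨_, ⟨c, y⟩, ⟨_, hy⟩, rfl⟩ h
    obtain ⟨i, hi⟩ := exists_conePoint_vertex_true_eq ha0 hy h
    exact ⟨i, Subtype.ext hi⟩
  · intro s i j b h
    exact vertex_eq_vertex_true s.2 (conePoint_injective ha0 (congrArg Subtype.val h))
  · intro s t j b h
    exact Subtype.ext (vertex_eq_vertex_zero_true s.2 t.2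
      (conePoint_injective ha0 (congrArg Subtype.val h))).1

end CrossPolytopeCone

theorem mainTheorem12 (𝕜 : Type*) [Field 𝕜] (α β : ℝ) (hα : 0 < α) (hαβ : α ≤ β)
    (k : ℕ) (hk : 1 ≤ k) :
    ∃ (X : Type) (_ : MetricSpace X) (_ : CompactSpace X),
      ∀ a ∈ Set.Icc α β,
        Cardinal.aleph0 < Module.rank 𝕜 ((Rips X a).simplicialHomology 𝕜 k) := by
  -- With k = m + 1, the m + 2 pairs of vertices span a k-sphere.
  obtain ⟨m, rfl⟩ := Nat.exists_eq_add_of_le' hk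
  refine ⟨CrossPolytopeCone.cone m α β, inferInstance,
    isCompact_iff_compactSpace.1 (CrossPolytopeCone.isCompact_cone m α β), fun a ha => ?_⟩
  obtain ⟨x, hx⟩ := CrossPolytopeCone.exists_linearIndependent_cone (m := m) 𝕜 hα ha
  have h := hx.cardinal_lift_le_rank
  rw [Cardinal.mk_Ioc_real zero_lt_one, Cardinal.lift_continuum] at h
  rw [← Cardinal.aleph0_lt_lift]
  exact Cardinal.aleph0_lt_continuum.trans_le h
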